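/- **Setting.** Let $G$ be a countably infinite set, $\mu:G\to(0,\infty)$ a node measure and $\omega:G\times G\to[0,\infty)$ a symmetric edge weight with $\omega(x,x)=0$ and $\sum_y\omega(x,y)<\infty$. The weighted graph $(G,\omega,\mu)$ is assumed locally finite and connected (with $x\sim y$ iff $\omega(x,y)>0$). Put $\Delta u(x)=\frac1{\mu(x)}\sum_y (u(y)-u(x))\,\omega(x,y)$. Let $\lambda_1(G)=\inf\operatorname{spec}(-\Delta)$, where $-\Delta$ is the self-adjoint (Friedrichs/Dirichlet) realization on $\ell^2(G,\mu)$. Let $p(x,y,t)$ be the minimal heat kernel, i.e. the increasing limit over finite $F\subset G$ of the Dirichlet heat kernels $p_F(x,y,t)$ (extended by $0$ outside $F\times F$), and $e^{t\Delta}u_0(x)=\sum_y p(x,y,t)u_0(y)\mu(y)$. Norms are $\|u\|_\infty=\sup_x|u(x)|$ and $\|u\|_1=\sum_x|u(x)|\mu(x)$. A (nonnegative) *global mild solution* of $u_t=\Delta u+f(u)$, $u(\cdot,0)=u_0$, is a nonnegative function $u\in L^\infty((0,\infty);\ell^\infty(G))$ such that, for all $x\in G$ and $t>0$, $$u(x,t)=\sum_{y}p(x,y,t)u_0(y)\mu(y)+\int_0^t\sum_{y}p(x,y,t-s)f(u(y,s))\mu(y)\,ds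 .$$ A global mild solution of the Dirichlet problem on a finite set $F$ with datum $u_0$ is defined in the same way with $p_F$ in place of $p$, together with $u=0$ outside $F$. **Theorem.** Assume $\lambda_1(G)>0$. Let $f:[0,\infty)\to[0,\infty)$ be locally Lipschitz and increasing with $f(0)=0$. Let $\delta>0$ be such that the Lipschitz constant $L$ of $f$ over $[0,\delta]$ satisfies $L=\lambda_1(G)$. Let $\underline C,\underline t>0$ be constants with $$p(x,y,t)\le \underline C\,e^{-\lambda_1(G)t}\qquad\text{for all }x,y\in G,\ t\ge\underline t .$$ Let $u_0\in\ell^\infty(G)\cap\ell^1(G)$, $u_0\ge0$, satisfy $$\|u_0\|_\infty\le\delta e^{-L\underline t},\qquad \|u_0\|_1\le\delta/\underline C .$$ Then there exists a global mild solution $u$, and $u$ is bounded on $G\times(0,\infty)$. Moreover $u$ can be chosen such that $0\le u(x,t)\le e^{Lt}(e^{t\Delta}u_0)(x)$ for all $x\in G$, $t>0$, and such that there are global mild solutions $u_F$ of the Dirichlet problems on the finite sets $F\subset G$ with datum $u_0$ that satisfy $0\le u_F\le e^{Lt}e^{t\Delta}u_0$, are nondecreasing in $F$, and converge pointwise to $u$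 as $F\uparrow G$ (in particular along the balls $B_R$ of the graph distance, as $R\to\infty$). -/

import Mathlib

open Set Filter Topology MeasureTheory
open scoped ENNReal NNReal

noncomputable section

/-- A weighted graph on the vertex set `V`: symmetric edge weight `ω` without loops and with finite
sum function, node measure `μ` with positive finite values; locally finite and connected. -/
structure WGraph (V : Type*) where
  ω : V → V → ℝ
  μ : V → ℝ
  ω_nonneg : ∀ x y, 0 ≤ ω x y
  ω_symm : ∀ x y, ω x y = ω y x
  ω_self : ∀ x, ω x x = 0
  ω_summable : ∀ x, Summable (ω x)
  μ_pos : ∀ x, 0 < μ x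
  locally_finite : ∀ x, {y | 0 < ω x y}.Finite
  connected : ∀ x y, Relation.ReflTransGen (fun a b => 0 < ω a b) x y

namespace WGraph

variable {V : Type*} (G : WGraph V)

/-- The weighted Laplacian `Δu(x) = (1/μ(x)) ∑_y (u(y) - u(x)) ω(x,y)`
(a finite sum, by local finiteness). -/
def laplacian (u : V → ℝ) (x : V) : ℝ :=
  (1 / G.μ x) * ∑' y, (u y - u x) * G.ω x y

/-! ### The bottom of the spectrum of `-Δ` on `ℓ²(V, μ)` -/

/-- `‖u‖²` in `ℓ²(V, μ)`, with values in `[0, ∞]`. -/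
def normSq (u : V → ℝ) : ℝ≥0∞ := ∑' x, ENNReal.ofReal (u x ^ 2 * G.μ x)

/-- The energy `(1/2) ∑_{x,y} ω(x,y) (u(y) - u(x))²`, with values in `[0, ∞]`. -/
def energy (u : V → ℝ) : ℝ≥0∞ :=
  (1 / 2) * ∑' x, ∑' y, ENNReal.ofReal (G.ω x y * (u y - u x) ^ 2)

/-- The space `ℓ²(V, μ)`. -/
def ell2 : Set (V → ℝ) := {u | G.normSq u < ⊤}

/-- The form domain: the closure of the finitely supported functions with respect to
`‖u‖² + energy u`. -/
def formDomain : Set (V → ℝ) :=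
  {u | ∃ φ : ℕ → V → ℝ, (∀ n, (Function.support (φ n)).Finite) ∧
    Tendsto (fun n => G.normSq (u - φ n) + G.energy (u - φ n)) atTop (𝓝 0)}

/-- The domain of the self-adjoint (Friedrichs, or Dirichlet) realization of `-Δ` in `ℓ²(V, μ)`,
which acts on its domain as the formal operator `-Δ`. -/
def operatorDomain : Set (V → ℝ) :=
  {u | u ∈ G.formDomain ∧ G.laplacian u ∈ G.ell2}

/-- The real resolvent set of `-Δ`: the `z` for which `-Δ - z` is a bijection from the operator
domain onto `ℓ²(V, μ)` with bounded inverse. -/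
def resolventSet : Set ℝ :=
  {z | BijOn (fun (u : V → ℝ) (x : V) => -G.laplacian u x - z * u x) G.operatorDomain G.ell2 ∧
    ∃ K : ℝ≥0, ∀ u ∈ G.operatorDomain,
      G.normSq u ≤ K * G.normSq (fun x => -G.laplacian u x - z * u x)}

/-- The spectrum of the self-adjoint operator `-Δ` (which is real). -/
def spectrum : Set ℝ := G.resolventSetᶜ

/-- `λ₁(G) = inf spec(-Δ)`. -/
def lambda1 : ℝ := sInf G.spectrum

/-! ### The minimal heat kernel and the heat semigroup -/

open Classical in
/-- The matrix of the Dirichlet Laplacian on the finite set `F`: functions on `F` are extended by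
zero, `Δ` is applied, and the result is restricted to `F`. -/
def dirichletMatrix (F : Finset V) : Matrix F F ℝ :=
  Matrix.of fun a b => G.laplacian (Pi.single (b : V) 1) a

open Classical in
/-- The heat kernel of the finite set `F` with homogeneous Dirichlet conditions outside `F`: the
kernel with respect to `μ` of the matrix exponential of `t` times the Dirichlet Laplacian, extended
by zero. -/
def dirichletKernel (F : Finset V) (x y : V) (t : ℝ) : ℝ :=
  if h : x ∈ F ∧ y ∈ F then
    (NormedSpace.exp (t • G.dirichletMatrix F)) ⟨x, h.1⟩ ⟨y, h.2⟩ / G.μ y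
  else 0

/-- The minimal heat kernel `p(x,y,t)`: the increasing limit, that is the supremum, of the Dirichlet
heat kernels of the finite subsets (these are bounded above by `1 / μ(y)` for `t ≥ 0`). -/
def heatKernel (x y : V) (t : ℝ) : ℝ := ⨆ F : Finset V, G.dirichletKernel F x y t

/-- The heat semigroup `(e^{tΔ} u₀)(x) = ∑_y p(x,y,t) u₀(y) μ(y)`. -/
def heatSemigroup (t : ℝ) (u₀ : V → ℝ) (x : V) : ℝ :=
  ∑' y, G.heatKernel x y t * u₀ y * G.μ y

/-! ### Mild solutions -/

/-- `u` is a (nonnegative) mild solution on `V × (0,τ)` of `u_t = Δu + f(u)`, `u(0) = u₀`, where the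
linear evolution is the one with kernel `k` with respect to `μ`: `u ∈ L^∞((0,τ), ℓ^∞)`, and
`u(x,t) = ∑_y k(x,y,t) u₀(y) μ(y) + ∫_0^t ∑_y k(x,y,t-s) f(u(y,s)) μ(y) ds` for all `x` and all
`t ∈ (0,τ)`, all sums and integrals being convergent. -/
structure IsMildSolution (k : V → V → ℝ → ℝ) (f : ℝ → ℝ) (u₀ : V → ℝ) (τ : EReal)
    (u : V → ℝ → ℝ) : Prop where
  nonneg : ∀ x, ∀ t : ℝ, 0 < t → (t : EReal) < τ → 0 ≤ u x t
  aestronglyMeasurable : ∀ x,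
    AEStronglyMeasurable (u x) (volume.restrict {t : ℝ | 0 < t ∧ (t : EReal) < τ})
  bounded : ∃ M : ℝ, ∀ x, ∀ t : ℝ, 0 < t → (t : EReal) < τ → |u x t| ≤ M
  summable_initial : ∀ x, ∀ t : ℝ, 0 < t → (t : EReal) < τ →
    Summable fun y => k x y t * u₀ y * G.μ y
  summable_source : ∀ x, ∀ t : ℝ, 0 < t → (t : EReal) < τ → ∀ s ∈ Ioo 0 t,
    Summable fun y => k x y (t - s) * f (u y s) * G.μ y
  integrable_source : ∀ x, ∀ t : ℝ, 0 < t → (t : EReal) < τ →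
    IntervalIntegrable (fun s => ∑' y, k x y (t - s) * f (u y s) * G.μ y) volume 0 t
  mild : ∀ x, ∀ t : ℝ, 0 < t → (t : EReal) < τ →
    u x t = ∑' y, k x y t * u₀ y * G.μ y +
      ∫ s in (0 : ℝ)..t, ∑' y, k x y (t - s) * f (u y s) * G.μ y

/-- A global solution: a mild solution on `V × (0,∞)` with respect to the heat kernel. -/
def IsGlobalSolution (f : ℝ → ℝ) (u₀ : V → ℝ) (u : V → ℝ → ℝ) : Prop :=
  G.IsMildSolution G.heatKernel f u₀ ⊤ u

/-- A global mild solution of the Dirichlet problem on the finite set `F`, with `u = 0` outside `F`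
and initial datum `u₀` in `F`. As the Dirichlet kernel vanishes outside `F × F`, its sums
run over `F` only. -/
def IsDirichletSolution (F : Finset V) (f : ℝ → ℝ) (u₀ : V → ℝ) (u : V → ℝ → ℝ) : Prop :=
  G.IsMildSolution (G.dirichletKernel F) f u₀ ⊤ u ∧ ∀ x ∉ F, ∀ t : ℝ, 0 < t → u x t = 0

end WGraph

/-- The (least) Lipschitz constant of `f` over `[0, δ]`. -/
def lipConst (f : ℝ → ℝ) (δ : ℝ) : ℝ :=
  sInf {K : ℝ | 0 ≤ K ∧ ∀ a ∈ Icc 0 δ, ∀ b ∈ Icc 0 δ, |f a - f b| ≤ K * |a - b|}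

end

/-! Write P_t for the heat semigroup and L for the common value of λ₁ and the Lipschitz constant.
Since f(a) ≤ L a on [0,δ], the function e^{Lt} P_t u₀ is a supersolution as long as it stays below
δ. It does so for all times: up to t₀ because P_t is sub-Markovian and u₀ ≤ δ e^{-L t₀}, afterwards
because the kernel is at most C e^{-Lt} and the ℓ¹ norm of u₀ is at most δ/C. Growth and decay
cancel exactly (`exp_mul_heatSemigroup_le`).

On a finite set F, the Picard iterates started at 0 increase both with the iteration index and with
F, because the kernels are nonnegative and f is increasing (`picard_mono`). They stay below the
barrier (`picard_le`): inserting it into the Duhamel integral and using P_{t-s} P_s = P_t leaves (1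
+ ∫ L e^{Ls} ds) P_t u₀ = e^{Lt} P_t u₀. Hence the limits in n and then in F exist by monotonicity.
Both pass through the integral equation by dominated convergence, the source being bounded by Lδ
(`isMildSolution_of_tendsto`).

The kernel facts needed (positivity, monotonicity in F, mass at most 1) come from adding a large
multiple of the identity to the Dirichlet matrix. Its entries become nonnegative, and exponential
series can be compared term by term. -/

section MatrixExponential

/-! ### Exponentials of entrywise nonnegative matrices -/

variable {ι κ : Type*} [Fintype ι] [DecidableEq ι] [Fintype κ] [DecidableEq κ]

theorem Matrix.hasSum_exp_apply (B : Matrix ι ι ℝ) (a b : ι) :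
    HasSum (fun n : ℕ => (n.factorial : ℝ)⁻¹ * (B ^ n) a b) (NormedSpace.exp B a b) := by
  -- The statement does not depend on a norm; one is chosen locally to have the exponential series
  -- in a Banach algebra.
  let _ : NormedRing (Matrix ι ι ℝ) := Matrix.linftyOpNormedRing
  let _ : NormedAlgebra ℝ (Matrix ι ι ℝ) := Matrix.linftyOpNormedAlgebra
  let _ : NormedAlgebra ℚ (Matrix ι ι ℝ) := .restrictScalars ℚ ℝ _
  have h := NormedSpace.exp_series_hasSum_exp' (𝕂 := ℝ) B
  exact Pi.hasSum.1 (Pi.hasSum.1 h a) b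

theorem Matrix.continuous_exp_smul_apply (A : Matrix ι ι ℝ) (a b : ι) :
    Continuous fun t : ℝ => NormedSpace.exp (t • A) a b := by
  let _ : NormedRing (Matrix ι ι ℝ) := Matrix.linftyOpNormedRing
  let _ : NormedAlgebra ℝ (Matrix ι ι ℝ) := Matrix.linftyOpNormedAlgebra
  let _ : NormedAlgebra ℚ (Matrix ι ι ℝ) := .restrictScalars ℚ ℝ _
  have h : Continuous fun t : ℝ => NormedSpace.exp (t • A) :=
    NormedSpace.exp_continuous.comp (continuous_id.smul continuous_const)
  exact (continuous_apply b).comp ((continuous_apply a).comp h)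

theorem Matrix.exp_apply_nonneg {B : Matrix ι ι ℝ} (hB : ∀ a b, 0 ≤ B a b) (a b : ι) :
    0 ≤ NormedSpace.exp B a b :=
  (B.hasSum_exp_apply a b).nonneg fun n => mul_nonneg (by positivity) (pow_apply_nonneg hB n a b)

/-- An entry of a power is a sum of weights over walks; the larger index set keeps every walk, with
at least the same weight, and adds only nonnegative ones. -/
theorem Matrix.pow_apply_le_of_embedding {B : Matrix ι ι ℝ} {B' : Matrix κ κ ℝ} (e : ι ↪ κ)
    (hB : ∀ a b, 0 ≤ B a b) (hB' : ∀ a b, 0 ≤ B' a b) (h : ∀ a b, B a b ≤ B' (e a) (e b))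
    (n : ℕ) (a b : ι) : (B ^ n) a b ≤ (B' ^ n) (e a) (e b) := by
  induction n generalizing a b with
  | zero => simp [Matrix.one_apply]
  | succ n ih =>
    rw [pow_succ, pow_succ, Matrix.mul_apply, Matrix.mul_apply]
    calc ∑ z, (B ^ n) a z * B z b ≤ ∑ z, (B' ^ n) (e a) (e z) * B' (e z) (e b) :=
          Finset.sum_le_sum fun z _ =>
            mul_le_mul (ih a z) (h z b) (hB z b) (pow_apply_nonneg hB' n _ _)
      _ = ∑ z ∈ Finset.univ.map e, (B' ^ n) (e a) z * B' z (e b) := by rw [Finset.sum_map]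
      _ ≤ _ := Finset.sum_le_sum_of_subset_of_nonneg (Finset.subset_univ _)
          fun z _ _ => mul_nonneg (pow_apply_nonneg hB' n _ _) (hB' _ _)

theorem Matrix.exp_apply_le_of_embedding {B : Matrix ι ι ℝ} {B' : Matrix κ κ ℝ} (e : ι ↪ κ)
    (hB : ∀ a b, 0 ≤ B a b) (hB' : ∀ a b, 0 ≤ B' a b) (h : ∀ a b, B a b ≤ B' (e a) (e b))
    (a b : ι) : NormedSpace.exp B a b ≤ NormedSpace.exp B' (e a) (e b) :=
  hasSum_le (fun n => mul_le_mul_of_nonneg_left (pow_apply_le_of_embedding e hB hB' h n a b)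
    (by positivity)) (B.hasSum_exp_apply a b) (B'.hasSum_exp_apply (e a) (e b))

theorem Matrix.sum_pow_apply_le {B : Matrix ι ι ℝ} {c : ℝ} (hB : ∀ a b, 0 ≤ B a b)
    (hc : ∀ a, ∑ b, B a b ≤ c) (n : ℕ) (a : ι) : ∑ b, (B ^ n) a b ≤ c ^ n := by
  have hc0 : 0 ≤ c := (Finset.sum_nonneg fun b _ => hB a b).trans (hc a)
  induction n generalizing a with
  | zero => simp [Matrix.one_apply]
  | succ n ih =>
    simp only [pow_succ, Matrix.mul_apply]
    rw [Finset.sum_comm]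
    calc ∑ z, ∑ b, (B ^ n) a z * B z b ≤ ∑ z, (B ^ n) a z * c := Finset.sum_le_sum fun z _ => by
          rw [← Finset.mul_sum]
          exact mul_le_mul_of_nonneg_left (hc z) (pow_apply_nonneg hB n a z)
      _ ≤ _ := by
          rw [← Finset.sum_mul]
          exact mul_le_mul_of_nonneg_right (ih a) hc0

theorem Matrix.sum_exp_apply_le {B : Matrix ι ι ℝ} {c : ℝ} (hB : ∀ a b, 0 ≤ B a b)
    (hc : ∀ a, ∑ b, B a b ≤ c) (a : ι) : ∑ b, NormedSpace.exp B a b ≤ Real.exp c := by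
  have h1 := hasSum_sum fun b (_ : b ∈ Finset.univ) => B.hasSum_exp_apply a b
  have h2 : HasSum (fun n : ℕ => (n.factorial : ℝ)⁻¹ • c ^ n) (NormedSpace.exp c) :=
    NormedSpace.exp_series_hasSum_exp' (𝕂 := ℝ) c
  rw [← Real.exp_eq_exp_ℝ] at h2
  refine hasSum_le (fun n => ?_) h1 h2
  rw [← Finset.mul_sum, smul_eq_mul]
  exact mul_le_mul_of_nonneg_left (sum_pow_apply_le hB hc n a) (by positivity)

theorem Matrix.exp_smul_one (c : ℝ) :
    NormedSpace.exp (c • (1 : Matrix ι ι ℝ)) = Real.exp c • (1 : Matrix ι ι ℝ) := by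
  have h : c • (1 : Matrix ι ι ℝ) = Matrix.diagonal fun _ => c := by
    rw [← Matrix.diagonal_one, ← Matrix.diagonal_smul]; congr 1; ext; simp
  rw [h, Matrix.exp_diagonal, ← Matrix.diagonal_one, ← Matrix.diagonal_smul]
  congr 1
  ext
  simp [Real.exp_eq_exp_ℝ]

theorem Matrix.exp_add_smul_one (B : Matrix ι ι ℝ) (c : ℝ) :
    NormedSpace.exp (B + c • (1 : Matrix ι ι ℝ)) = Real.exp c • NormedSpace.exp B := by
  rw [Matrix.exp_add_of_commute _ _ ((Commute.one_right B).smul_right c), Matrix.exp_smul_one,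
    Matrix.mul_smul, mul_one]

/-- The exponential of `t • A` in terms of that of the shifted matrix `A + c`. -/
theorem Matrix.exp_smul_eq_shift (A : Matrix ι ι ℝ) (c t : ℝ) :
    NormedSpace.exp (t • A) =
      Real.exp (-(t * c)) • NormedSpace.exp (t • (A + c • (1 : Matrix ι ι ℝ))) := by
  rw [← Matrix.exp_add_smul_one]
  congr 1
  rw [smul_add, smul_smul, neg_smul, add_neg_cancel_right]

end MatrixExponential

/-! ### Dirichlet matrices and heat kernels -/

namespace WGraph

variable {V : Type*} (G : WGraph V)

open Classical in
theorem laplacian_single (a b : V) :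
    G.laplacian (Pi.single b 1) a = (G.ω a b - if a = b then ∑' y, G.ω a y else 0) / G.μ a := by
  have h1 : HasSum (fun y => (Pi.single b (1 : ℝ) : V → ℝ) y * G.ω a y) (G.ω a b) := by
    convert hasSum_single (f := fun y => (Pi.single b (1 : ℝ) : V → ℝ) y * G.ω a y) b
      (fun y hy => by simp [hy]) using 1
    simp
  have h2 := (G.ω_summable a).hasSum.mul_left ((Pi.single b (1 : ℝ) : V → ℝ) a)
  have h3 := (h1.sub h2).tsum_eq
  simp only [← sub_mul] at h3
  rw [laplacian, h3, one_div, inv_mul_eq_div]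
  by_cases hab : a = b <;> simp [hab]

theorem degree_nonneg (a : V) : 0 ≤ (∑' y, G.ω a y) / G.μ a :=
  div_nonneg (tsum_nonneg (G.ω_nonneg a)) (G.μ_pos a).le

/-- A bound for the diagonal of the Dirichlet Laplacian on `F`. -/
noncomputable def degreeSum (F : Finset V) : ℝ := ∑ a ∈ F, (∑' y, G.ω a y) / G.μ a

theorem degree_le_degreeSum {F : Finset V} {a : V} (ha : a ∈ F) :
    (∑' y, G.ω a y) / G.μ a ≤ G.degreeSum F :=
  Finset.single_le_sum (f := fun a => (∑' y, G.ω a y) / G.μ a)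
    (fun b _ => G.degree_nonneg b) ha

theorem degreeSum_mono {F F' : Finset V} (h : F ⊆ F') : G.degreeSum F ≤ G.degreeSum F' :=
  Finset.sum_le_sum_of_subset_of_nonneg h fun b _ _ => G.degree_nonneg b

open Classical in
theorem dirichletMatrix_shift_apply (F : Finset V) (c : ℝ) (a b : F) :
    (G.dirichletMatrix F + c • (1 : Matrix F F ℝ)) a b =
      G.ω a b / G.μ a + if (a : V) = b then c - (∑' y, G.ω a y) / G.μ a else 0 := by
  rw [Matrix.add_apply, Matrix.smul_apply, Matrix.one_apply, dirichletMatrix, Matrix.of_apply,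
    laplacian_single, sub_div]
  by_cases h : (a : V) = b
  · simp [h, Subtype.ext_iff]; ring
  · simp [h, Subtype.ext_iff]

-- Off the diagonal the entries ω/μ are already nonnegative; the shift only has to dominate the
-- weighted degrees on the diagonal.
open Classical in
theorem dirichletMatrix_shift_nonneg {F : Finset V} {c : ℝ} (hc : G.degreeSum F ≤ c) (a b : F) :
    0 ≤ (G.dirichletMatrix F + c • (1 : Matrix F F ℝ)) a b := by
  rw [dirichletMatrix_shift_apply]
  refine add_nonneg (div_nonneg (G.ω_nonneg _ _) (G.μ_pos _).le) ?_
  split_ifs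
  · exact sub_nonneg.2 ((G.degree_le_degreeSum a.2).trans hc)
  · exact le_rfl

-- The row sum is c minus the weight of the edges leaving F, divided by the measure: mass is only
-- lost, through the boundary.
open Classical in
theorem sum_dirichletMatrix_shift_le (F : Finset V) (c : ℝ) (a : F) :
    ∑ b, (G.dirichletMatrix F + c • (1 : Matrix F F ℝ)) a b ≤ c := by
  simp only [dirichletMatrix_shift_apply]
  rw [Finset.sum_add_distrib]
  have h1 : (∑ b : F, if (a : V) = b then c - (∑' y, G.ω a y) / G.μ a else 0) =
      c - (∑' y, G.ω a y) / G.μ a := by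
    simp only [← Subtype.ext_iff]
    simp
  have h2 : ∑ b : F, G.ω a b / G.μ a ≤ (∑' y, G.ω a y) / G.μ a := by
    rw [← Finset.sum_div, Finset.sum_coe_sort F (G.ω a)]
    exact div_le_div_of_nonneg_right
      ((G.ω_summable a).sum_le_tsum F fun y _ => G.ω_nonneg a y) (G.μ_pos a).le
  linarith

/-! ### Dirichlet heat kernels -/

theorem dirichletKernel_of_notMem_left {F : Finset V} {x : V} (hx : x ∉ F) (y : V) (t : ℝ) :
    G.dirichletKernel F x y t = 0 :=
  dif_neg fun h => hx h.1

theorem dirichletKernel_of_notMem_right {F : Finset V} {y : V} (hy : y ∉ F) (x : V) (t : ℝ) :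
    G.dirichletKernel F x y t = 0 :=
  dif_neg fun h => hy h.2

open Classical in
theorem dirichletKernel_mul_measure {F : Finset V} (x y : F) (t : ℝ) :
    G.dirichletKernel F x y t * G.μ y = NormedSpace.exp (t • G.dirichletMatrix F) x y := by
  rw [dirichletKernel, dif_pos ⟨x.2, y.2⟩, div_mul_cancel₀ _ (G.μ_pos _).ne']

theorem continuous_dirichletKernel (F : Finset V) (x y : V) :
    Continuous (G.dirichletKernel F x y) := by
  classical
  by_cases h : x ∈ F ∧ y ∈ F
  · have : G.dirichletKernel F x y = fun t =>
        NormedSpace.exp (t • G.dirichletMatrix F) ⟨x, h.1⟩ ⟨y, h.2⟩ / G.μ y :=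
      funext fun t => dif_pos h
    rw [this]
    exact (Matrix.continuous_exp_smul_apply _ _ _).div_const _
  · have : G.dirichletKernel F x y = fun _ => 0 := funext fun t => dif_neg h
    rw [this]
    exact continuous_const

theorem dirichletKernel_nonneg (F : Finset V) (x y : V) {t : ℝ} (ht : 0 ≤ t) :
    0 ≤ G.dirichletKernel F x y t := by
  classical
  rw [dirichletKernel]
  split_ifs with h
  · refine div_nonneg ?_ (G.μ_pos y).le
    rw [Matrix.exp_smul_eq_shift _ (G.degreeSum F)]
    exact mul_nonneg (Real.exp_pos _).le (Matrix.exp_apply_nonneg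
      (fun a b => mul_nonneg ht (G.dirichletMatrix_shift_nonneg le_rfl a b)) _ _)
  · exact le_rfl

theorem dirichletKernel_mono {F F' : Finset V} (hF : F ⊆ F') (x y : V) {t : ℝ} (ht : 0 ≤ t) :
    G.dirichletKernel F x y t ≤ G.dirichletKernel F' x y t := by
  classical
  by_cases h : x ∈ F ∧ y ∈ F
  · rw [dirichletKernel, dirichletKernel, dif_pos h, dif_pos ⟨hF h.1, hF h.2⟩]
    refine div_le_div_of_nonneg_right ?_ (G.μ_pos y).le
    -- The same shift, that of the larger set, serves both matrices, so that their entries agree on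
    -- F × F and both are nonnegative.
    have hc := G.degreeSum_mono hF
    rw [Matrix.exp_smul_eq_shift (G.dirichletMatrix F) (G.degreeSum F') t,
      Matrix.exp_smul_eq_shift (G.dirichletMatrix F') (G.degreeSum F') t]
    refine mul_le_mul_of_nonneg_left ?_ (Real.exp_pos _).le
    refine Matrix.exp_apply_le_of_embedding ⟨fun a : F => (⟨a, hF a.2⟩ : F'), fun a b hab => ?_⟩
      (fun a b => mul_nonneg ht (G.dirichletMatrix_shift_nonneg hc a b))
      (fun a b => mul_nonneg ht (G.dirichletMatrix_shift_nonneg le_rfl a b))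
      (fun a b => mul_le_mul_of_nonneg_left ?_ ht) ⟨x, h.1⟩ ⟨y, h.2⟩
    · exact Subtype.ext (congrArg (fun c : F' => (c : V)) hab)
    · rw [dirichletMatrix_shift_apply, dirichletMatrix_shift_apply]
      exact le_rfl
  · rw [dirichletKernel, dif_neg h]
    exact G.dirichletKernel_nonneg F' x y ht

/-- Sub-Markov property: the shifted matrix has row sums at most c, so its exponential has row sums
at most e^{tc}, which the factor e^{-tc} from the shift cancels. -/
theorem sum_dirichletKernel_le_one (F S : Finset V) (x : V) {t : ℝ} (ht : 0 ≤ t) :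
    ∑ y ∈ S, G.dirichletKernel F x y t * G.μ y ≤ 1 := by
  classical
  by_cases hx : x ∈ F
  · calc ∑ y ∈ S, G.dirichletKernel F x y t * G.μ y
        ≤ ∑ y ∈ S ∪ F, G.dirichletKernel F x y t * G.μ y :=
          Finset.sum_le_sum_of_subset_of_nonneg Finset.subset_union_left fun y _ _ =>
            mul_nonneg (G.dirichletKernel_nonneg F x y ht) (G.μ_pos y).le
      _ = ∑ y ∈ F, G.dirichletKernel F x y t * G.μ y :=
          (Finset.sum_subset Finset.subset_union_right fun y _ hy => by
            rw [G.dirichletKernel_of_notMem_right hy, zero_mul]).symm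
      _ = ∑ y : F, NormedSpace.exp (t • G.dirichletMatrix F) ⟨x, hx⟩ y := by
          rw [← Finset.sum_coe_sort]
          exact Finset.sum_congr rfl fun y _ => G.dirichletKernel_mul_measure ⟨x, hx⟩ y t
      _ = Real.exp (-(t * G.degreeSum F)) * ∑ y : F, NormedSpace.exp
            (t • (G.dirichletMatrix F + G.degreeSum F • (1 : Matrix F F ℝ))) ⟨x, hx⟩ y := by
          rw [Matrix.exp_smul_eq_shift _ (G.degreeSum F), Finset.mul_sum]
          rfl
      _ ≤ Real.exp (-(t * G.degreeSum F)) * Real.exp (t * G.degreeSum F) := by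
          refine mul_le_mul_of_nonneg_left (Matrix.sum_exp_apply_le
            (fun a b => mul_nonneg ht (G.dirichletMatrix_shift_nonneg le_rfl a b))
            (fun a => ?_) _) (Real.exp_pos _).le
          have := mul_le_mul_of_nonneg_left (G.sum_dirichletMatrix_shift_le F (G.degreeSum F) a) ht
          rwa [Finset.mul_sum] at this
      _ = 1 := by rw [← Real.exp_add, neg_add_cancel, Real.exp_zero]
  · simp [G.dirichletKernel_of_notMem_left hx]

/-- The Chapman–Kolmogorov equation for the Dirichlet heat kernel. -/
theorem sum_dirichletKernel_mul (F : Finset V) (x z : V) (s t : ℝ) :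
    ∑ y ∈ F, G.dirichletKernel F x y s * G.dirichletKernel F y z t * G.μ y =
      G.dirichletKernel F x z (s + t) := by
  classical
  by_cases h : x ∈ F ∧ z ∈ F
  · have h1 : NormedSpace.exp ((s + t) • G.dirichletMatrix F) =
        NormedSpace.exp (s • G.dirichletMatrix F) * NormedSpace.exp (t • G.dirichletMatrix F) := by
      rw [add_smul, Matrix.exp_add_of_commute]
      exact ((Commute.refl _).smul_left s).smul_right t
    have h2 := congrFun₂ h1 ⟨x, h.1⟩ ⟨z, h.2⟩
    rw [Matrix.mul_apply, ← G.dirichletKernel_mul_measure] at h2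
    refine mul_right_cancel₀ (G.μ_pos z).ne' ?_
    rw [h2, ← Finset.sum_coe_sort, Finset.sum_mul]
    refine Finset.sum_congr rfl fun y _ => ?_
    rw [← G.dirichletKernel_mul_measure, ← G.dirichletKernel_mul_measure]
    ring
  · rw [show G.dirichletKernel F x z (s + t) = 0 from dif_neg h]
    refine Finset.sum_eq_zero fun y _ => ?_
    rcases not_and_or.1 h with h | h
    · rw [G.dirichletKernel_of_notMem_left h, zero_mul, zero_mul]
    · rw [G.dirichletKernel_of_notMem_right h, mul_zero, zero_mul]

/-! ### The minimal heat kernel -/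

/-- One term of the sub-Markov sum gives the bound. It makes the real supremum defining `heatKernel`
genuine rather than the default value 0. -/
theorem bddAbove_dirichletKernel (x y : V) {t : ℝ} (ht : 0 ≤ t) :
    BddAbove (range fun F : Finset V => G.dirichletKernel F x y t) := by
  refine ⟨1 / G.μ y, ?_⟩
  rintro _ ⟨F, rfl⟩
  rw [le_div_iff₀ (G.μ_pos y)]
  simpa using G.sum_dirichletKernel_le_one F {y} x ht

theorem dirichletKernel_le_heatKernel (F : Finset V) (x y : V) {t : ℝ} (ht : 0 ≤ t) :
    G.dirichletKernel F x y t ≤ G.heatKernel x y t :=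
  le_ciSup (G.bddAbove_dirichletKernel x y ht) F

theorem heatKernel_nonneg (x y : V) {t : ℝ} (ht : 0 ≤ t) : 0 ≤ G.heatKernel x y t :=
  (G.dirichletKernel_nonneg ∅ x y ht).trans (G.dirichletKernel_le_heatKernel ∅ x y ht)

theorem tendsto_dirichletKernel (x y : V) {t : ℝ} (ht : 0 ≤ t) :
    Tendsto (fun F => G.dirichletKernel F x y t) atTop (𝓝 (G.heatKernel x y t)) :=
  tendsto_atTop_ciSup (fun _ _ h => G.dirichletKernel_mono h x y ht)
    (G.bddAbove_dirichletKernel x y ht)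

theorem sum_heatKernel_le_one (S : Finset V) (x : V) {t : ℝ} (ht : 0 ≤ t) :
    ∑ y ∈ S, G.heatKernel x y t * G.μ y ≤ 1 :=
  le_of_tendsto (tendsto_finsetSum S fun y _ => (G.tendsto_dirichletKernel x y ht).mul_const _)
    (Eventually.of_forall fun F => G.sum_dirichletKernel_le_one F S x ht)

theorem summable_heatKernel (x : V) {t : ℝ} (ht : 0 ≤ t) :
    Summable fun y => G.heatKernel x y t * G.μ y :=
  summable_of_sum_le (fun y => mul_nonneg (G.heatKernel_nonneg x y ht) (G.μ_pos y).le)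
    fun S => G.sum_heatKernel_le_one S x ht

theorem tsum_heatKernel_le_one (x : V) {t : ℝ} (ht : 0 ≤ t) :
    ∑' y, G.heatKernel x y t * G.μ y ≤ 1 :=
  (G.summable_heatKernel x ht).tsum_le_of_sum_le fun S => G.sum_heatKernel_le_one S x ht

end WGraph

/-! ### Sub-Markovian averages and limits of mild solutions -/

namespace WGraph

variable {V : Type*} (G : WGraph V)

theorem summable_dirichletKernel (F : Finset V) (x : V) {t : ℝ} (ht : 0 ≤ t) :
    Summable fun y => G.dirichletKernel F x y t * G.μ y :=
  summable_of_sum_le (fun y => mul_nonneg (G.dirichletKernel_nonneg F x y ht) (G.μ_pos y).le)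
    fun S => G.sum_dirichletKernel_le_one F S x ht

theorem tsum_dirichletKernel_le_one (F : Finset V) (x : V) {t : ℝ} (ht : 0 ≤ t) :
    ∑' y, G.dirichletKernel F x y t * G.μ y ≤ 1 :=
  (G.summable_dirichletKernel F x ht).tsum_le_of_sum_le fun S =>
    G.sum_dirichletKernel_le_one F S x ht

/-- Averages of bounded functions against a sub-Markovian kernel converge, if the kernels and the
functions do. -/
theorem tendsto_tsum_kernel {ι : Type*} {l : Filter ι} {k : V → ℝ} {kk : ι → V → ℝ}
    {h : V → ℝ} {hh : ι → V → ℝ} {M : ℝ}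
    (hkk0 : ∀ i y, 0 ≤ kk i y) (hkk : ∀ i y, kk i y ≤ k y)
    (hk : ∀ y, Tendsto (fun i => kk i y) l (𝓝 (k y))) (hs : Summable fun y => k y * G.μ y)
    (hh0 : ∀ i y, 0 ≤ hh i y) (hhM : ∀ i y, hh i y ≤ M)
    (hh' : ∀ y, Tendsto (fun i => hh i y) l (𝓝 (h y))) :
    Tendsto (fun i => ∑' y, kk i y * hh i y * G.μ y) l (𝓝 (∑' y, k y * h y * G.μ y)) := by
  refine tendsto_tsum_of_dominated_convergence (bound := fun y => M * (k y * G.μ y))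
    (hs.mul_left M) (fun y => ((hk y).mul (hh' y)).mul_const _)
    (Eventually.of_forall fun i y => ?_)
  rw [Real.norm_of_nonneg (mul_nonneg (mul_nonneg (hkk0 i y) (hh0 i y)) (G.μ_pos y).le)]
  calc kk i y * hh i y * G.μ y ≤ k y * M * G.μ y :=
        mul_le_mul_of_nonneg_right (mul_le_mul (hkk i y) (hhM i y) (hh0 i y)
          ((hkk0 i y).trans (hkk i y))) (G.μ_pos y).le
    _ = _ := by ring

theorem summable_kernel_mul {k h : V → ℝ} {M : ℝ} (hk : ∀ y, 0 ≤ k y)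
    (hs : Summable fun y => k y * G.μ y) (h0 : ∀ y, 0 ≤ h y) (hM : ∀ y, h y ≤ M) :
    Summable fun y => k y * h y * G.μ y := by
  refine Summable.of_nonneg_of_le
    (fun y => mul_nonneg (mul_nonneg (hk y) (h0 y)) (G.μ_pos y).le) (fun y => ?_) (hs.mul_left M)
  calc k y * h y * G.μ y ≤ k y * M * G.μ y :=
        mul_le_mul_of_nonneg_right (mul_le_mul_of_nonneg_left (hM y) (hk y)) (G.μ_pos y).le
    _ = _ := by ring

theorem tsum_kernel_mul_le {k h : V → ℝ} {M : ℝ} (hk : ∀ y, 0 ≤ k y)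
    (hs : Summable fun y => k y * G.μ y) (h1 : ∑' y, k y * G.μ y ≤ 1) (h0 : ∀ y, 0 ≤ h y)
    (hM0 : 0 ≤ M) (hM : ∀ y, h y ≤ M) : ∑' y, k y * h y * G.μ y ≤ M := by
  calc ∑' y, k y * h y * G.μ y ≤ ∑' y, M * (k y * G.μ y) := by
        refine (G.summable_kernel_mul hk hs h0 hM).tsum_le_tsum (fun y => ?_) (hs.mul_left M)
        calc k y * h y * G.μ y ≤ k y * M * G.μ y :=
              mul_le_mul_of_nonneg_right (mul_le_mul_of_nonneg_left (hM y) (hk y)) (G.μ_pos y).le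
          _ = _ := by ring
    _ = M * ∑' y, k y * G.μ y := tsum_mul_left
    _ ≤ M := mul_le_of_le_one_right hM0 h1

theorem tsum_kernel_mul_nonneg {k h : V → ℝ} (hk : ∀ y, 0 ≤ k y) (h0 : ∀ y, 0 ≤ h y) :
    0 ≤ ∑' y, k y * h y * G.μ y :=
  tsum_nonneg fun y => mul_nonneg (mul_nonneg (hk y) (h0 y)) (G.μ_pos y).le

/-- Passage to the limit in the mild formulation, with respect to a sub-Markovian kernel `k` which
is the limit of smaller kernels `kk i`: if `w i` is bounded and has the same limit `u` as the
right-hand side `w' i` of the integral equation for `w i`, then `u` is a mild solution. -/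
theorem isMildSolution_of_tendsto {ι : Type*} {l : Filter ι} [l.NeBot] [l.IsCountablyGenerated]
    {k : V → V → ℝ → ℝ} {kk : ι → V → V → ℝ → ℝ} {f : ℝ → ℝ} {u₀ : V → ℝ} {δ M D : ℝ}
    {w w' : ι → V → ℝ → ℝ} {u : V → ℝ → ℝ}
    (hfc : ContinuousOn f (Ici 0)) (hf0 : ∀ a ∈ Icc 0 δ, 0 ≤ f a) (hfM : ∀ a ∈ Icc 0 δ, f a ≤ M)
    (hM : 0 ≤ M)
    (hkk0 : ∀ i x y t, 0 ≤ t → 0 ≤ kk i x y t)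
    (hkk : ∀ i x y t, 0 ≤ t → kk i x y t ≤ k x y t)
    (hk : ∀ x y t, 0 ≤ t → Tendsto (fun i => kk i x y t) l (𝓝 (k x y t)))
    (hs : ∀ x t, 0 ≤ t → Summable fun y => k x y t * G.μ y)
    (hk1 : ∀ x t, 0 ≤ t → ∑' y, k x y t * G.μ y ≤ 1)
    (hu₀ : ∀ x, 0 ≤ u₀ x) (hu₀D : ∀ x, u₀ x ≤ D)
    (hw : ∀ i x t, 0 < t → w i x t ∈ Icc 0 δ)
    (hwu : ∀ x t, 0 < t → Tendsto (fun i => w i x t) l (𝓝 (u x t)))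
    (hwu' : ∀ x t, 0 < t → Tendsto (fun i => w' i x t) l (𝓝 (u x t)))
    (hmeas : ∀ i x, AEStronglyMeasurable (w i x) (volume.restrict (Ioi 0)))
    (hsrc : ∀ i x t, 0 < t → AEStronglyMeasurable
      (fun s => ∑' y, kk i x y (t - s) * f (w i y s) * G.μ y) (volume.restrict (Ioc 0 t)))
    (heq : ∀ i x t, 0 < t → w' i x t = ∑' y, kk i x y t * u₀ y * G.μ y +
      ∫ s in (0 : ℝ)..t, ∑' y, kk i x y (t - s) * f (w i y s) * G.μ y) :
    G.IsMildSolution k f u₀ ⊤ u := by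
  have hset : {t : ℝ | 0 < t ∧ (t : EReal) < ⊤} = Ioi 0 := by
    ext t; simp [EReal.coe_lt_top]
  have hk0 : ∀ x y t, 0 ≤ t → 0 ≤ k x y t := fun x y t ht =>
    ge_of_tendsto (hk x y t ht) (Eventually.of_forall fun i => hkk0 i x y t ht)
  have hu : ∀ x t, 0 < t → u x t ∈ Icc 0 δ := fun x t ht =>
    isClosed_Icc.mem_of_tendsto (hwu x t ht) (Eventually.of_forall fun i => hw i x t ht)
  have hlim : ∀ x t, ∀ s ∈ Ioc 0 t, Tendsto
      (fun i => ∑' y, kk i x y (t - s) * f (w i y s) * G.μ y) l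
      (𝓝 (∑' y, k x y (t - s) * f (u y s) * G.μ y)) := fun x t s hs' => by
    have hts : 0 ≤ t - s := sub_nonneg.2 hs'.2
    refine G.tendsto_tsum_kernel (fun i y => hkk0 i x y _ hts) (fun i y => hkk i x y _ hts)
      (fun y => hk x y _ hts) (hs x _ hts) (fun i y => hf0 _ (hw i y s hs'.1))
      (fun i y => hfM _ (hw i y s hs'.1)) fun y => ?_
    -- The nonlinearity is continuous only on [0,∞), so the convergence has to take place within
    -- that set.
    have h1 : Tendsto (fun i => w i y s) l (𝓝[Ici 0] (u y s)) :=
      tendsto_nhdsWithin_iff.2 ⟨hwu y s hs'.1, Eventually.of_forall fun i => (hw i y s hs'.1).1⟩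
    exact (hfc _ (hu y s hs'.1).1).tendsto.comp h1
  have hbound : ∀ i x t, ∀ s ∈ Ioc 0 t,
      ‖∑' y, kk i x y (t - s) * f (w i y s) * G.μ y‖ ≤ M := fun i x t s hs' => by
    have hts : 0 ≤ t - s := sub_nonneg.2 hs'.2
    have hs1 : Summable fun y => kk i x y (t - s) * G.μ y :=
      Summable.of_nonneg_of_le (fun y => mul_nonneg (hkk0 i x y _ hts) (G.μ_pos y).le)
        (fun y => mul_le_mul_of_nonneg_right (hkk i x y _ hts) (G.μ_pos y).le) (hs x _ hts)
    rw [Real.norm_of_nonneg (G.tsum_kernel_mul_nonneg (fun y => hkk0 i x y _ hts)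
      fun y => hf0 _ (hw i y s hs'.1))]
    refine G.tsum_kernel_mul_le (fun y => hkk0 i x y _ hts) hs1 (le_trans ?_ (hk1 x _ hts))
      (fun y => hf0 _ (hw i y s hs'.1)) hM (fun y => hfM _ (hw i y s hs'.1))
    exact hs1.tsum_le_tsum
      (fun y => mul_le_mul_of_nonneg_right (hkk i x y _ hts) (G.μ_pos y).le) (hs x _ hts)
  refine ⟨fun x t ht _ => (hu x t ht).1, fun x => ?_, ⟨δ, fun x t ht _ => ?_⟩,
    fun x t ht _ => ?_, fun x t ht _ s hs' => ?_, fun x t ht _ => ?_, fun x t ht _ => ?_⟩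
  · rw [hset]
    refine aestronglyMeasurable_of_tendsto_ae l (fun i => hmeas i x) ?_
    exact (ae_restrict_iff' measurableSet_Ioi).2 (Eventually.of_forall fun t ht => hwu x t ht)
  · rw [abs_of_nonneg (hu x t ht).1]
    exact (hu x t ht).2
  · exact G.summable_kernel_mul (fun y => hk0 x y t ht.le) (hs x t ht.le) hu₀ hu₀D
  · have hts : 0 ≤ t - s := sub_nonneg.2 hs'.2.le
    exact G.summable_kernel_mul (fun y => hk0 x y _ hts) (hs x _ hts)
      (fun y => hf0 _ (hu y s hs'.1)) (fun y => hfM _ (hu y s hs'.1))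
  · rw [intervalIntegrable_iff_integrableOn_Ioc_of_le ht.le]
    refine Integrable.of_bound (μ := volume.restrict (Ioc 0 t))
      (aestronglyMeasurable_of_tendsto_ae l (fun i => hsrc i x t ht) ?_) M ?_
    · exact (ae_restrict_iff' measurableSet_Ioc).2 (Eventually.of_forall fun s hs' => hlim x t s hs')
    · exact (ae_restrict_iff' measurableSet_Ioc).2 (Eventually.of_forall fun s hs' =>
        le_of_tendsto (hlim x t s hs').norm (Eventually.of_forall fun i => hbound i x t s hs'))
  · have h1 := G.tendsto_tsum_kernel (fun i y => hkk0 i x y _ ht.le)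
      (fun i y => hkk i x y _ ht.le) (fun y => hk x y _ ht.le) (hs x _ ht.le)
      (fun i y => hu₀ y) (fun i y => hu₀D y) fun y => tendsto_const_nhds
    have h2 := intervalIntegral.tendsto_integral_filter_of_dominated_convergence
      (μ := volume) (a := 0) (b := t) (l := l) (fun _ => M)
      (F := fun i s => ∑' y, kk i x y (t - s) * f (w i y s) * G.μ y)
      (f := fun s => ∑' y, k x y (t - s) * f (u y s) * G.μ y)
      (Eventually.of_forall fun i => by rw [uIoc_of_le ht.le]; exact hsrc i x t ht)
      (Eventually.of_forall fun i => Eventually.of_forall fun s hs' =>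
        hbound i x t s (by rwa [uIoc_of_le ht.le] at hs'))
      intervalIntegrable_const
      (Eventually.of_forall fun s hs' => hlim x t s (by rwa [uIoc_of_le ht.le] at hs'))
    refine tendsto_nhds_unique (hwu' x t ht) ((h1.add h2).congr fun i => (heq i x t ht).symm)

end WGraph

/-! ### Dirichlet semigroups and Picard iteration on finite sets -/

namespace WGraph

variable {V : Type*} (G : WGraph V)

/-- The heat semigroup of the finite set `F` with Dirichlet conditions outside `F`. -/
noncomputable def dirichletSemigroup (F : Finset V) (t : ℝ) (u₀ : V → ℝ) (x : V) : ℝ :=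
  ∑ y ∈ F, G.dirichletKernel F x y t * u₀ y * G.μ y

theorem continuous_dirichletSemigroup (F : Finset V) (u₀ : V → ℝ) (x : V) :
    Continuous fun t => G.dirichletSemigroup F t u₀ x :=
  continuous_finsetSum _ fun y _ =>
    ((G.continuous_dirichletKernel F x y).mul continuous_const).mul continuous_const

theorem tsum_dirichletKernel_mul (F : Finset V) (x : V) (t : ℝ) (h : V → ℝ) :
    ∑' y, G.dirichletKernel F x y t * h y * G.μ y = G.dirichletSemigroup F t h x :=
  tsum_eq_sum fun y hy => by rw [G.dirichletKernel_of_notMem_right hy, zero_mul, zero_mul]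

theorem dirichletSemigroup_of_notMem {F : Finset V} {x : V} (hx : x ∉ F) (t : ℝ) (h : V → ℝ) :
    G.dirichletSemigroup F t h x = 0 :=
  Finset.sum_eq_zero fun y _ => by rw [G.dirichletKernel_of_notMem_left hx, zero_mul, zero_mul]

theorem dirichletSemigroup_nonneg (F : Finset V) {t : ℝ} (ht : 0 ≤ t) {h : V → ℝ}
    (h0 : ∀ y, 0 ≤ h y) (x : V) : 0 ≤ G.dirichletSemigroup F t h x :=
  Finset.sum_nonneg fun y _ =>
    mul_nonneg (mul_nonneg (G.dirichletKernel_nonneg F x y ht) (h0 y)) (G.μ_pos y).le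

theorem dirichletSemigroup_mono {F F' : Finset V} (hF : F ⊆ F') {t : ℝ} (ht : 0 ≤ t)
    {h h' : V → ℝ} (h0 : ∀ y, 0 ≤ h y) (hh : ∀ y, h y ≤ h' y) (x : V) :
    G.dirichletSemigroup F t h x ≤ G.dirichletSemigroup F' t h' x := by
  have h0' : ∀ y, 0 ≤ h' y := fun y => (h0 y).trans (hh y)
  calc G.dirichletSemigroup F t h x
      ≤ ∑ y ∈ F, G.dirichletKernel F' x y t * h' y * G.μ y := Finset.sum_le_sum fun y _ =>
        mul_le_mul_of_nonneg_right (mul_le_mul (G.dirichletKernel_mono hF x y ht) (hh y) (h0 y)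
          (G.dirichletKernel_nonneg F' x y ht)) (G.μ_pos y).le
    _ ≤ _ := Finset.sum_le_sum_of_subset_of_nonneg hF fun y _ _ =>
        mul_nonneg (mul_nonneg (G.dirichletKernel_nonneg F' x y ht) (h0' y)) (G.μ_pos y).le

theorem dirichletSemigroup_const_mul (F : Finset V) (t c : ℝ) (h : V → ℝ) (x : V) :
    G.dirichletSemigroup F t (fun y => c * h y) x = c * G.dirichletSemigroup F t h x := by
  rw [dirichletSemigroup, dirichletSemigroup, Finset.mul_sum]
  exact Finset.sum_congr rfl fun y _ => by ring

theorem dirichletSemigroup_comp (F : Finset V) (s t : ℝ) (h : V → ℝ) (x : V) :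
    G.dirichletSemigroup F s (G.dirichletSemigroup F t h) x =
      G.dirichletSemigroup F (s + t) h x := by
  simp only [dirichletSemigroup, Finset.mul_sum, Finset.sum_mul]
  rw [Finset.sum_comm]
  refine Finset.sum_congr rfl fun z _ => ?_
  rw [← G.sum_dirichletKernel_mul, Finset.sum_mul, Finset.sum_mul]
  exact Finset.sum_congr rfl fun y _ => by ring

theorem dirichletSemigroup_le_heatSemigroup (F : Finset V) {t : ℝ} (ht : 0 ≤ t) {h : V → ℝ}
    {D : ℝ} (h0 : ∀ y, 0 ≤ h y) (hD : ∀ y, h y ≤ D) (x : V) :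
    G.dirichletSemigroup F t h x ≤ G.heatSemigroup t h x := by
  have hs := G.summable_kernel_mul (fun y => G.heatKernel_nonneg x y ht)
    (G.summable_heatKernel x ht) h0 hD
  refine le_trans (Finset.sum_le_sum fun y _ => ?_) (hs.sum_le_tsum F fun y _ =>
    mul_nonneg (mul_nonneg (G.heatKernel_nonneg x y ht) (h0 y)) (G.μ_pos y).le)
  exact mul_le_mul_of_nonneg_right (mul_le_mul_of_nonneg_right
    (G.dirichletKernel_le_heatKernel F x y ht) (h0 y)) (G.μ_pos y).le

/-- Picard iterates for the Dirichlet problem on `F`; the nonlinearity is frozen at negative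
arguments. -/
noncomputable def picard (F : Finset V) (f : ℝ → ℝ) (u₀ : V → ℝ) : ℕ → V → ℝ → ℝ
  | 0 => fun _ _ => 0
  | n + 1 => fun x t => G.dirichletSemigroup F t u₀ x +
      ∫ s in (0 : ℝ)..t, G.dirichletSemigroup F (t - s) (fun y => f (max (picard F f u₀ n y s) 0)) x

variable {G} {F F' : Finset V} {f : ℝ → ℝ} {u₀ : V → ℝ} {L δ : ℝ}

/-- Continuity is needed for all real s and t, while signs are known only for nonnegative times; the
truncation keeps the argument of f where f is continuous. -/
theorem continuous_picard_integrand {w : V → ℝ → ℝ} (hf : ContinuousOn f (Ici 0))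
    (hw : ∀ y, Continuous (w y)) (x : V) :
    Continuous (Function.uncurry fun t s : ℝ =>
      G.dirichletSemigroup F (t - s) (fun y => f (max (w y s) 0)) x) := by
  refine continuous_finsetSum _ fun y _ => Continuous.mul (Continuous.mul ?_ ?_) continuous_const
  · exact (G.continuous_dirichletKernel F x y).comp (continuous_fst.sub continuous_snd)
  · exact hf.comp_continuous (((hw y).comp continuous_snd).max continuous_const)
      fun p => mem_Ici.2 (le_max_right _ _)

theorem continuous_picard (hf : ContinuousOn f (Ici 0)) (n : ℕ) (x : V) :
    Continuous (G.picard F f u₀ n x) := by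
  induction n generalizing x with
  | zero => exact continuous_const
  | succ n ih =>
    exact (G.continuous_dirichletSemigroup F u₀ x).add
      (intervalIntegral.continuous_parametric_intervalIntegral_of_continuous
        (continuous_picard_integrand hf ih x) continuous_id)

theorem continuous_picard_integrand_right (hf : ContinuousOn f (Ici 0)) (n : ℕ) (x : V) (t : ℝ) :
    Continuous fun s => G.dirichletSemigroup F (t - s)
      (fun y => f (max (G.picard F f u₀ n y s) 0)) x :=
  (continuous_picard_integrand hf (continuous_picard hf n) x).comp
    (continuous_const.prodMk continuous_id)

theorem picard_nonneg (hf0 : ∀ a, 0 ≤ a → 0 ≤ f a) (hu₀ : ∀ x, 0 ≤ u₀ x) (n : ℕ) (x : V)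
    {t : ℝ} (ht : 0 ≤ t) : 0 ≤ G.picard F f u₀ n x t := by
  cases n with
  | zero => exact le_rfl
  | succ n =>
    exact add_nonneg (G.dirichletSemigroup_nonneg F ht hu₀ x)
      (intervalIntegral.integral_nonneg ht fun s hs =>
        G.dirichletSemigroup_nonneg F (sub_nonneg.2 hs.2) (fun y => hf0 _ (le_max_right _ _)) x)

theorem picard_of_notMem {x : V} (hx : x ∉ F) (n : ℕ) (t : ℝ) : G.picard F f u₀ n x t = 0 := by
  cases n with
  | zero => rfl
  | succ n => simp [picard, G.dirichletSemigroup_of_notMem hx]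

/-- A single induction covers both monotonicities: in n, because the iteration starts at the
smallest value 0, and in F, through the kernels. -/
theorem picard_mono (hF : F ⊆ F') (hf : ContinuousOn f (Ici 0)) (hf0 : ∀ a, 0 ≤ a → 0 ≤ f a)
    (hfm : MonotoneOn f (Ici 0)) (hu₀ : ∀ x, 0 ≤ u₀ x) {n m : ℕ} (hnm : n ≤ m) (x : V)
    {t : ℝ} (ht : 0 ≤ t) : G.picard F f u₀ n x t ≤ G.picard F' f u₀ m x t := by
  induction n generalizing m x t with
  | zero => exact picard_nonneg hf0 hu₀ m x ht
  | succ n ih =>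
    obtain ⟨m, rfl⟩ := Nat.exists_eq_add_of_le' (Nat.one_le_of_lt hnm)
    refine add_le_add (G.dirichletSemigroup_mono hF ht hu₀ (fun _ => le_rfl) x)
      (intervalIntegral.integral_mono_on ht
        ((continuous_picard_integrand_right hf n x t).intervalIntegrable _ _)
        ((continuous_picard_integrand_right hf m x t).intervalIntegrable _ _) fun s hs => ?_)
    exact G.dirichletSemigroup_mono hF (sub_nonneg.2 hs.2) (fun y => hf0 _ (le_max_right _ _))
      (fun y => hfm (mem_Ici.2 (le_max_right _ _)) (mem_Ici.2 (le_max_right _ _))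
        (max_le_max_right _ (ih (Nat.le_of_succ_le_succ hnm) y hs.1))) x

theorem integral_mul_exp (L t : ℝ) : ∫ s in (0 : ℝ)..t, L * Real.exp (L * s) =
    Real.exp (L * t) - 1 := by
  have h : ∀ s ∈ uIcc 0 t, HasDerivAt (fun s => Real.exp (L * s)) (L * Real.exp (L * s)) s :=
    fun s _ => by simpa [mul_comm] using ((hasDerivAt_id s).const_mul L).exp
  rw [intervalIntegral.integral_eq_sub_of_hasDerivAt h
    ((by fun_prop : Continuous fun s => L * Real.exp (L * s)).intervalIntegrable _ _)]
  simp

/-- If `f` is bounded by `L a` on `[0, δ]` and the solution `e^{Lt} e^{tΔ} u₀` of the linear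
problem stays below `δ`, then it is a barrier for the Picard iterates. -/
theorem picard_le (hf : ContinuousOn f (Ici 0)) (hf0 : ∀ a, 0 ≤ a → 0 ≤ f a)
    (hfL : ∀ a ∈ Icc 0 δ, f a ≤ L * a) (hL : 0 ≤ L) (hu₀ : ∀ x, 0 ≤ u₀ x)
    (hδ : ∀ x t, 0 ≤ t → Real.exp (L * t) * G.dirichletSemigroup F t u₀ x ≤ δ)
    (n : ℕ) (x : V) {t : ℝ} (ht : 0 ≤ t) :
    G.picard F f u₀ n x t ≤ Real.exp (L * t) * G.dirichletSemigroup F t u₀ x := by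
  induction n generalizing x t with
  | zero => exact mul_nonneg (Real.exp_pos _).le (G.dirichletSemigroup_nonneg F ht hu₀ x)
  | succ n ih =>
    have hint : ∫ s in (0 : ℝ)..t, G.dirichletSemigroup F (t - s)
          (fun y => f (max (G.picard F f u₀ n y s) 0)) x ≤
        ∫ s in (0 : ℝ)..t, L * Real.exp (L * s) * G.dirichletSemigroup F t u₀ x := by
      refine intervalIntegral.integral_mono_on ht
        ((continuous_picard_integrand_right hf n x t).intervalIntegrable _ _)
        ((by fun_prop : Continuous fun s => L * Real.exp (L * s) *
          G.dirichletSemigroup F t u₀ x).intervalIntegrable _ _) fun s hs => ?_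
      -- By induction the iterate lies below the barrier, hence in [0,δ], where the linear bound on
      -- f is available.
      have hle : ∀ y, f (max (G.picard F f u₀ n y s) 0) ≤
          L * Real.exp (L * s) * G.dirichletSemigroup F s u₀ y := fun y => by
        have h0 := picard_nonneg (G := G) (F := F) hf0 hu₀ n y hs.1
        rw [max_eq_left h0, mul_assoc]
        exact (hfL _ ⟨h0, (ih y hs.1).trans (hδ y s hs.1)⟩).trans
          (mul_le_mul_of_nonneg_left (ih y hs.1) hL)
      have h1 := G.dirichletSemigroup_mono (Finset.Subset.refl F) (sub_nonneg.2 hs.2)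
        (fun y => hf0 _ (le_max_right _ _)) hle x
      -- The semigroup law turns P_{t-s} P_s u₀ into P_t u₀, so only the exponential depends on s.
      rwa [dirichletSemigroup_const_mul, dirichletSemigroup_comp, sub_add_cancel] at h1
    rw [intervalIntegral.integral_mul_const, integral_mul_exp] at hint
    calc G.picard F f u₀ (n + 1) x t ≤ G.dirichletSemigroup F t u₀ x +
          (Real.exp (L * t) - 1) * G.dirichletSemigroup F t u₀ x := add_le_add_right hint _
      _ = _ := by ring

end WGraph

theorem le_lipConst_mul {f : ℝ → ℝ} {δ : ℝ} (h0 : f 0 = 0)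
    (hf : LocallyLipschitzOn (Ici 0) f) {a : ℝ} (ha : a ∈ Icc 0 δ) : f a ≤ lipConst f δ * a := by
  rcases ha.1.eq_or_lt with rfl | hpos
  · simp [h0]
  · rw [← div_le_iff₀ hpos]
    refine le_csInf ?_ fun K hK => ?_
    -- Compactness of [0,δ] makes the set of Lipschitz constants nonempty; otherwise its infimum
    -- would be the default 0.
    · obtain ⟨K, hK⟩ := (hf.mono (Icc_subset_Ici_self : Icc 0 δ ⊆ Ici 0)
        ).exists_lipschitzOnWith_of_compact isCompact_Icc
      exact ⟨K, K.2, fun x hx y hy => by simpa [Real.dist_eq] using hK.dist_le_mul x hx y hy⟩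
    · rw [div_le_iff₀ hpos]
      have := hK.2 a ha 0 ⟨le_rfl, ha.1.trans ha.2⟩
      rw [h0, sub_zero, sub_zero, abs_of_pos hpos] at this
      exact (le_abs_self _).trans this

/-! ### Minimal Dirichlet solutions and the global barrier -/

namespace WGraph

variable {V : Type*} (G : WGraph V)

/-- The minimal Dirichlet solution on `F`: the limit of the Picard iterates. -/
noncomputable def picardLimit (F : Finset V) (f : ℝ → ℝ) (u₀ : V → ℝ) (x : V) (t : ℝ) : ℝ :=
  ⨆ n, G.picard F f u₀ n x t

variable {G} {F F' : Finset V} {f : ℝ → ℝ} {u₀ : V → ℝ} {L δ D : ℝ}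

theorem bddAbove_picard (hf : ContinuousOn f (Ici 0)) (hf0 : ∀ a, 0 ≤ a → 0 ≤ f a)
    (hfL : ∀ a ∈ Icc 0 δ, f a ≤ L * a) (hL : 0 ≤ L) (hu₀ : ∀ x, 0 ≤ u₀ x)
    (hδ : ∀ x t, 0 ≤ t → Real.exp (L * t) * G.dirichletSemigroup F t u₀ x ≤ δ)
    (x : V) {t : ℝ} (ht : 0 ≤ t) : BddAbove (range fun n => G.picard F f u₀ n x t) :=
  ⟨_, forall_mem_range.2 fun n => picard_le hf hf0 hfL hL hu₀ hδ n x ht⟩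

theorem tendsto_picard (hf : ContinuousOn f (Ici 0)) (hf0 : ∀ a, 0 ≤ a → 0 ≤ f a)
    (hfm : MonotoneOn f (Ici 0)) (hfL : ∀ a ∈ Icc 0 δ, f a ≤ L * a) (hL : 0 ≤ L)
    (hu₀ : ∀ x, 0 ≤ u₀ x)
    (hδ : ∀ x t, 0 ≤ t → Real.exp (L * t) * G.dirichletSemigroup F t u₀ x ≤ δ)
    (x : V) {t : ℝ} (ht : 0 ≤ t) :
    Tendsto (fun n => G.picard F f u₀ n x t) atTop (𝓝 (G.picardLimit F f u₀ x t)) :=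
  tendsto_atTop_ciSup
    (fun _ _ hnm => picard_mono (Finset.Subset.refl F) hf hf0 hfm hu₀ hnm x ht)
    (bddAbove_picard hf hf0 hfL hL hu₀ hδ x ht)

theorem picardLimit_le (hf : ContinuousOn f (Ici 0)) (hf0 : ∀ a, 0 ≤ a → 0 ≤ f a)
    (hfL : ∀ a ∈ Icc 0 δ, f a ≤ L * a) (hL : 0 ≤ L) (hu₀ : ∀ x, 0 ≤ u₀ x)
    (hδ : ∀ x t, 0 ≤ t → Real.exp (L * t) * G.dirichletSemigroup F t u₀ x ≤ δ)
    (x : V) {t : ℝ} (ht : 0 ≤ t) :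
    G.picardLimit F f u₀ x t ≤ Real.exp (L * t) * G.dirichletSemigroup F t u₀ x :=
  ciSup_le fun n => picard_le hf hf0 hfL hL hu₀ hδ n x ht

theorem picardLimit_nonneg (hf0 : ∀ a, 0 ≤ a → 0 ≤ f a) (hu₀ : ∀ x, 0 ≤ u₀ x)
    (x : V) {t : ℝ} (ht : 0 ≤ t) : 0 ≤ G.picardLimit F f u₀ x t :=
  Real.iSup_nonneg fun n => picard_nonneg hf0 hu₀ n x ht

theorem picardLimit_mono (hF : F ⊆ F') (hf : ContinuousOn f (Ici 0))
    (hf0 : ∀ a, 0 ≤ a → 0 ≤ f a) (hfm : MonotoneOn f (Ici 0))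
    (hfL : ∀ a ∈ Icc 0 δ, f a ≤ L * a) (hL : 0 ≤ L) (hu₀ : ∀ x, 0 ≤ u₀ x)
    (hδ : ∀ x t, 0 ≤ t → Real.exp (L * t) * G.dirichletSemigroup F' t u₀ x ≤ δ)
    (x : V) {t : ℝ} (ht : 0 ≤ t) : G.picardLimit F f u₀ x t ≤ G.picardLimit F' f u₀ x t :=
  ciSup_mono (bddAbove_picard hf hf0 hfL hL hu₀ hδ x ht) fun _ =>
    picard_mono hF hf hf0 hfm hu₀ le_rfl x ht

theorem isDirichletSolution_picardLimit (hf : ContinuousOn f (Ici 0))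
    (hf0 : ∀ a, 0 ≤ a → 0 ≤ f a) (hfm : MonotoneOn f (Ici 0))
    (hfL : ∀ a ∈ Icc 0 δ, f a ≤ L * a) (hL : 0 ≤ L) (hδ0 : 0 ≤ δ) (hu₀ : ∀ x, 0 ≤ u₀ x)
    (hu₀D : ∀ x, u₀ x ≤ D)
    (hδ : ∀ x t, 0 ≤ t → Real.exp (L * t) * G.dirichletSemigroup F t u₀ x ≤ δ) :
    G.IsDirichletSolution F f u₀ (G.picardLimit F f u₀) := by
  refine ⟨?_, fun x hx t _ => by simp [picardLimit, picard_of_notMem hx]⟩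
  have hmem : ∀ n x t, 0 < t → G.picard F f u₀ n x t ∈ Icc 0 δ := fun n x t ht =>
    ⟨picard_nonneg hf0 hu₀ n x ht.le,
      (picard_le hf hf0 hfL hL hu₀ hδ n x ht.le).trans (hδ x t ht.le)⟩
  have hlim := fun x t (ht : 0 < t) => tendsto_picard hf hf0 hfm hfL hL hu₀ hδ x ht.le
  have hsource : ∀ n x t, EqOn
      (fun s => ∑' y, G.dirichletKernel F x y (t - s) * f (G.picard F f u₀ n y s) * G.μ y)
      (fun s => G.dirichletSemigroup F (t - s) (fun y => f (max (G.picard F f u₀ n y s) 0)) x)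
      (Ioc 0 t) := fun n x t s hs => by
    dsimp only
    rw [tsum_dirichletKernel_mul G F x (t - s) (fun y => f (G.picard F f u₀ n y s))]
    simp only [max_eq_left (picard_nonneg (G := G) (F := F) hf0 hu₀ n _ hs.1.le)]
  -- The kernel is constant along the sequence. The right-hand side of the equation for the n-th
  -- iterate is the next iterate, which has the same limit.
  refine G.isMildSolution_of_tendsto (l := atTop) (δ := δ) (M := L * δ) (D := D)
    (kk := fun _ => G.dirichletKernel F) (w := G.picard F f u₀)
    (w' := fun n => G.picard F f u₀ (n + 1)) hf (fun a ha => hf0 a ha.1)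
    (fun a ha => (hfL a ha).trans (mul_le_mul_of_nonneg_left ha.2 hL)) (mul_nonneg hL hδ0)
    (fun _ x y t ht => G.dirichletKernel_nonneg F x y ht) (fun _ x y t _ => le_rfl)
    (fun x y t _ => tendsto_const_nhds) (fun x t ht => G.summable_dirichletKernel F x ht)
    (fun x t ht => G.tsum_dirichletKernel_le_one F x ht) hu₀ hu₀D hmem hlim
    (fun x t ht => (tendsto_add_atTop_iff_nat 1).2 (hlim x t ht))
    (fun n x => (continuous_picard hf n x).aestronglyMeasurable)
    (fun n x t _ => ?_) (fun n x t ht => ?_)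
  · refine (continuous_picard_integrand_right (G := G) (F := F) (u₀ := u₀) hf n x t
      ).aestronglyMeasurable.congr ?_
    exact (ae_restrict_iff' measurableSet_Ioc).2
      (Eventually.of_forall fun s hs => (hsource n x t hs).symm)
  · rw [tsum_dirichletKernel_mul]
    refine congrArg (G.dirichletSemigroup F t u₀ x + ·) ?_
    refine intervalIntegral.integral_congr_ae (Eventually.of_forall fun s hs => ?_)
    rw [uIoc_of_le ht.le] at hs
    exact (hsource n x t hs).symm

variable (G) in
/-- The bounds `1` (sub-Markov property) and `C e^{-λ t}` for the heat kernel, for short and for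
long times. -/
theorem exp_mul_heatSemigroup_le {C t₀ : ℝ} (hL : 0 ≤ L) (hδ : 0 ≤ δ) (hC : 0 < C)
    (hker : ∀ x y : V, ∀ t : ℝ, t₀ ≤ t → G.heatKernel x y t ≤ C * Real.exp (-L * t))
    (hu₀ : ∀ x, 0 ≤ u₀ x) (hu₀D : ∀ x, u₀ x ≤ δ * Real.exp (-L * t₀))
    (hsum : Summable fun x => u₀ x * G.μ x) (hone : ∑' x, u₀ x * G.μ x ≤ δ / C)
    (x : V) {t : ℝ} (ht : 0 ≤ t) : Real.exp (L * t) * G.heatSemigroup t u₀ x ≤ δ := by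
  have hk0 : ∀ y, 0 ≤ G.heatKernel x y t := fun y => G.heatKernel_nonneg x y ht
  suffices h : G.heatSemigroup t u₀ x ≤ δ * Real.exp (-L * t) by
    calc Real.exp (L * t) * G.heatSemigroup t u₀ x
        ≤ Real.exp (L * t) * (δ * Real.exp (-L * t)) :=
          mul_le_mul_of_nonneg_left h (Real.exp_pos _).le
      _ = δ * Real.exp (L * t + -L * t) := by rw [Real.exp_add]; ring
      _ = δ := by rw [neg_mul, add_neg_cancel, Real.exp_zero, mul_one]
  rcases le_total t t₀ with h | h
  -- Short times: the supremum of u₀ is not increased, and e^{-L t₀} ≤ e^{-Lt}.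
  · refine (G.tsum_kernel_mul_le hk0 (G.summable_heatKernel x ht) (G.tsum_heatKernel_le_one x ht)
      hu₀ (mul_nonneg hδ (Real.exp_pos _).le) hu₀D).trans ?_
    refine mul_le_mul_of_nonneg_left (Real.exp_le_exp.2 ?_) hδ
    exact mul_le_mul_of_nonpos_left h (neg_nonpos.2 hL)
  -- Long times: the uniform kernel bound is paired with the ℓ¹ norm, and C cancels.
  · calc G.heatSemigroup t u₀ x
        ≤ ∑' y, C * Real.exp (-L * t) * (u₀ y * G.μ y) := by
          refine (G.summable_kernel_mul hk0 (G.summable_heatKernel x ht) hu₀ hu₀D).tsum_le_tsum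
            (fun y => ?_) (hsum.mul_left _)
          rw [mul_assoc]
          exact mul_le_mul_of_nonneg_right (hker x y t h) (mul_nonneg (hu₀ y) (G.μ_pos y).le)
      _ = C * Real.exp (-L * t) * ∑' y, u₀ y * G.μ y := tsum_mul_left
      _ ≤ C * Real.exp (-L * t) * (δ / C) :=
          mul_le_mul_of_nonneg_left hone (mul_nonneg hC.le (Real.exp_pos _).le)
      _ = δ * Real.exp (-L * t) := by field_simp

end WGraph

/-! ### Exhaustion by finite sets -/

theorem theorem3 {V : Type*} [Countable V] [Infinite V] (G : WGraph V)
    (hlam : 0 < G.lambda1)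
    (f : ℝ → ℝ) (hf_maps : MapsTo f (Ici 0) (Ici 0)) (hf_lip : LocallyLipschitzOn (Ici 0) f)
    (hf_mono : MonotoneOn f (Ici 0)) (hf_zero : f 0 = 0)
    (δ : ℝ) (hδ : 0 < δ) (hL : lipConst f δ = G.lambda1)
    -- the constants in the long-time upper bound of the heat kernel
    (C t₀ : ℝ) (hC : 0 < C) (ht₀ : 0 < t₀)
    (hker : ∀ x y : V, ∀ t : ℝ, t₀ ≤ t → G.heatKernel x y t ≤ C * Real.exp (-G.lambda1 * t))
    -- the initial datum, in `ℓ^∞ ∩ ℓ^1`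
    (u₀ : V → ℝ) (hu₀_nonneg : ∀ x, 0 ≤ u₀ x)
    (hu₀_bdd : BddAbove (range fun x => |u₀ x|))
    (hu₀_sum : Summable fun x => |u₀ x| * G.μ x)
    (hu₀_inf : ⨆ x, |u₀ x| ≤ δ * Real.exp (-lipConst f δ * t₀))
    (hu₀_one : ∑' x, |u₀ x| * G.μ x ≤ δ / C) :
    ∃ u : V → ℝ → ℝ, G.IsGlobalSolution f u₀ u ∧
      (∃ M : ℝ, ∀ x, ∀ t : ℝ, 0 < t → |u x t| ≤ M) ∧
      (∀ x, ∀ t : ℝ, 0 < t →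
        u x t ≤ Real.exp (lipConst f δ * t) * G.heatSemigroup t u₀ x) ∧
      -- `u` is the monotone limit of global solutions of the Dirichlet problems on finite sets
      ∃ w : Finset V → V → ℝ → ℝ,
        (∀ F, G.IsDirichletSolution F f u₀ (w F)) ∧
        (∀ F, ∀ x, ∀ t : ℝ, 0 < t →
          w F x t ≤ Real.exp (lipConst f δ * t) * G.heatSemigroup t u₀ x) ∧
        (∀ F F' : Finset V, F ⊆ F' → ∀ x, ∀ t : ℝ, 0 < t → w F x t ≤ w F' x t) ∧
        (∀ x, ∀ t : ℝ, 0 < t → Tendsto (fun F => w F x t) atTop (𝓝 (u x t))) := by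
  have hL0 : 0 ≤ lipConst f δ := hL ▸ hlam.le
  have hfL : ∀ a ∈ Icc 0 δ, f a ≤ lipConst f δ * a := fun a ha =>
    le_lipConst_mul hf_zero hf_lip ha
  rw [← hL] at hker
  -- From here on L is only a nonnegative rate with f(a) ≤ L a on [0,δ] and kernel decay C e^{-Lt}.
  generalize lipConst f δ = L at *
  have hf : ContinuousOn f (Ici 0) := hf_lip.continuousOn
  have hf0 : ∀ a, 0 ≤ a → 0 ≤ f a := fun a ha => hf_maps ha
  have hu₀D : ∀ x, u₀ x ≤ δ * Real.exp (-L * t₀) := fun x =>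
    (le_abs_self _).trans ((le_ciSup hu₀_bdd x).trans hu₀_inf)
  simp only [abs_of_nonneg (hu₀_nonneg _)] at hu₀_sum hu₀_one
  have hheat : ∀ x t, 0 ≤ t → Real.exp (L * t) * G.heatSemigroup t u₀ x ≤ δ := fun x t ht =>
    G.exp_mul_heatSemigroup_le hL0 hδ.le hC hker hu₀_nonneg hu₀D hu₀_sum hu₀_one x ht
  have hle : ∀ F x t, 0 ≤ t → Real.exp (L * t) * G.dirichletSemigroup F t u₀ x ≤
      Real.exp (L * t) * G.heatSemigroup t u₀ x := fun F x t ht =>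
    mul_le_mul_of_nonneg_left
      (G.dirichletSemigroup_le_heatSemigroup F ht hu₀_nonneg hu₀D x) (Real.exp_pos _).le
  have hdir : ∀ F x t, 0 ≤ t → Real.exp (L * t) * G.dirichletSemigroup F t u₀ x ≤ δ :=
    fun F x t ht => (hle F x t ht).trans (hheat x t ht)
  set w : Finset V → V → ℝ → ℝ := fun F => G.picardLimit F f u₀
  have hw : ∀ F, G.IsDirichletSolution F f u₀ (w F) := fun F =>
    WGraph.isDirichletSolution_picardLimit hf hf0 hf_mono hfL hL0 hδ.le hu₀_nonneg hu₀D (hdir F)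
  have hw_le : ∀ F x t, 0 < t → w F x t ≤ Real.exp (L * t) * G.heatSemigroup t u₀ x :=
    fun F x t ht => (WGraph.picardLimit_le hf hf0 hfL hL0 hu₀_nonneg (hdir F) x ht.le).trans
      (hle F x t ht.le)
  have hw_mem : ∀ F x t, 0 < t → w F x t ∈ Icc 0 δ := fun F x t ht =>
    ⟨WGraph.picardLimit_nonneg hf0 hu₀_nonneg x ht.le, (hw_le F x t ht).trans (hheat x t ht.le)⟩
  have hw_mono : ∀ F F' : Finset V, F ⊆ F' → ∀ x, ∀ t : ℝ, 0 < t → w F x t ≤ w F' x t :=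
    fun F F' h x t ht =>
      WGraph.picardLimit_mono h hf hf0 hf_mono hfL hL0 hu₀_nonneg (hdir F') x ht.le
  have hlim : ∀ x t, 0 < t → Tendsto (fun F => w F x t) atTop (𝓝 (⨆ F, w F x t)) :=
    fun x t ht => tendsto_atTop_ciSup (fun F F' h => hw_mono F F' h x t ht)
      ⟨δ, forall_mem_range.2 fun F => (hw_mem F x t ht).2⟩
  have hset : {t : ℝ | 0 < t ∧ (t : EReal) < ⊤} = Ioi 0 := by
    ext t; simp [EReal.coe_lt_top]
  refine ⟨fun x t => ⨆ F, w F x t, ?_, ⟨δ, fun x t ht => ?_⟩,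
    fun x t ht => ciSup_le fun F => hw_le F x t ht, w, hw, hw_le, hw_mono, hlim⟩
  -- Since V is countable, `atTop` on its finite subsets is countably generated, as dominated
  -- convergence requires. Each `w F` solves its own integral equation, so it also serves as `w'`.
  · refine G.isMildSolution_of_tendsto (l := atTop) (δ := δ) (M := L * δ)
      (D := δ * Real.exp (-L * t₀)) (kk := G.dirichletKernel) (w := w) (w' := w)
      hf (fun a ha => hf0 a ha.1)
      (fun a ha => (hfL a ha).trans (mul_le_mul_of_nonneg_left ha.2 hL0)) (mul_nonneg hL0 hδ.le)
      (fun F x y t ht => G.dirichletKernel_nonneg F x y ht)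
      (fun F x y t ht => G.dirichletKernel_le_heatKernel F x y ht)
      (fun x y t ht => G.tendsto_dirichletKernel x y ht)
      (fun x t ht => G.summable_heatKernel x ht) (fun x t ht => G.tsum_heatKernel_le_one x ht)
      hu₀_nonneg hu₀D hw_mem hlim hlim (fun F x => ?_) (fun F x t ht => ?_)
      (fun F x t ht => (hw F).1.mild x t ht (EReal.coe_lt_top t))
    · rw [← hset]
      exact (hw F).1.aestronglyMeasurable x
    · exact ((intervalIntegrable_iff_integrableOn_Ioc_of_le ht.le).1
        ((hw F).1.integrable_source x t ht (EReal.coe_lt_top t))).aestronglyMeasurable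
  · rw [abs_of_nonneg (Real.iSup_nonneg fun F => (hw_mem F x t ht).1)]
    exact ciSup_le fun F => (hw_mem F x t ht).2
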